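/- For an integer $n\ge 0$ let \[ \Theta_n(q,x)=\sum_{j=0}^{n} q^{j(j+1)/2}x^j,\qquad \operatorname{Spec}_n=\{q\in\mathbb C\setminus\{0\}:\ \operatorname{disc}_x\Theta_n(q,x)=0\}, \] where $\operatorname{disc}_x$ is the discriminant with respect to $x$, and for an integer $m\ge0$ let \[ \Psi_m(q)=\sum_{k=0}^{m}(-1)^k(2k+1)\,q^{k(k+1)/2}. \] Then for every $\zeta\in\mathbb C$ with $|\zeta|=1$ there exist non-negative integers $m_s\to\infty$ and points $q_s\in\operatorname{Spec}_{2m_s+1}$ ($s=0,1,2,\dots$) such that $q_s\to\zeta$ as $s\to\infty$. Moreover, the points $q_s$ can be chosen so that, in addition, $\Psi_{m_s}(q_s)=0$ for every $s$. -/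

import Mathlib

open Polynomial Filter Topology

namespace PartialTheta

/-- The truncated partial theta polynomial `Θ_n(q, x) = ∑_{j=0}^n q^{j(j+1)/2} x^j`,
as a polynomial in `x` for a fixed complex number `q`. (The exponents `j(j+1)/2` are integers,
so the division of natural numbers is exact.) -/
noncomputable def truncTheta (n : ℕ) (q : ℂ) : ℂ[X] :=
  ∑ j ∈ Finset.range (n + 1), C (q ^ (j * (j + 1) / 2)) * X ^ j

/-- The truncation spectrum `Spec_n = {q ∈ ℂ^* : disc_x Θ_n(q, x) = 0}`. For `q ≠ 0` the polynomial
`Θ_n(q, x)` has exact degree `n` in `x`, so this is the usual discriminant in degree `n`. -/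
def truncSpec (n : ℕ) : Set ℂ :=
  {q : ℂ | q ≠ 0 ∧ (truncTheta n q).discr = 0}

/-- The polynomial `Ψ_m(q) = ∑_{k=0}^m (-1)^k (2k+1) q^{k(k+1)/2}` in the variable `q`. -/
noncomputable def Psi (m : ℕ) : ℂ[X] :=
  ∑ k ∈ Finset.range (m + 1), C ((-1 : ℂ) ^ k * (2 * (k : ℂ) + 1)) * X ^ (k * (k + 1) / 2)

end PartialTheta

/-!
If `q ^ (m + 1) * x = -1`, the terms of index `m - k` and `m + 1 + k` in `Θ_{2m+1}(q, x)` are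
opposite, so `x` is a root, and pairing the same terms in `x * ∂Θ_{2m+1}/∂x` leaves a nonzero
multiple of `Ψ_m(q)`. Hence every zero of `Ψ_m` makes `x` a double root and lies in the spectrum.

The `Ψ_m` are partial sums of a power series of radius of convergence `1`, so by Jentzsch's theorem
each point of the unit circle is a limit of their zeros.
-/

namespace PartialTheta

open Metric FormalMultilinearSeries
open scoped NNReal ENNReal

section Vitali

variable {ι E : Type*} [NormedAddCommGroup E] [NormedSpace ℂ E] [CompleteSpace E]
  {l : Filter ι} {f : ι → ℂ → E} {c : ℂ} {ρ R M : ℝ}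

theorem tendstoLocallyUniformlyOn_iteratedDeriv {g : ℂ → E} {U : Set ℂ} (hU : IsOpen U)
    (hf : ∀ᶠ i in l, DifferentiableOn ℂ (f i) U) (hfg : TendstoLocallyUniformlyOn f g l U)
    (n : ℕ) :
    TendstoLocallyUniformlyOn (fun i => iteratedDeriv n (f i)) (iteratedDeriv n g) l U := by
  induction n generalizing f g with
  | zero => simpa only [iteratedDeriv_zero] using hfg
  | succ n ih =>
    simp only [iteratedDeriv_succ']
    exact ih (hf.mono fun i hi => hi.deriv hU) (hfg.deriv hf hU)

/-- Each Taylor coefficient at `c` tends to zero, and Cauchy's estimates on a disc of radius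
between `‖z - c‖` and `R` dominate the Taylor series at `z` by one geometric series. -/
theorem tendsto_zero_of_tendstoUniformlyOn_ball (hρ : 0 < ρ)
    (hf : ∀ᶠ i in l, DifferentiableOn ℂ (f i) (ball c R))
    (hM : ∀ᶠ i in l, ∀ z ∈ ball c R, ‖f i z‖ ≤ M)
    (h0 : TendstoUniformlyOn f 0 l (ball c ρ)) {z : ℂ} (hz : z ∈ ball c R) :
    Tendsto (fun i => f i z) l (𝓝 0) := by
  have hR : 0 < R := pos_of_mem_ball hz
  obtain ⟨r, hzr, hrR⟩ := exists_between (mem_ball_iff_norm.1 hz)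
  have hr : 0 < r := (norm_nonneg _).trans_lt hzr
  have hcoeff (n : ℕ) : Tendsto (fun i => iteratedDeriv n (f i) c) l (𝓝 0) := by
    have hunif : TendstoLocallyUniformlyOn f 0 l (ball c (min ρ R)) :=
      (h0.mono (ball_subset_ball (min_le_left _ _))).tendstoLocallyUniformlyOn
    have hdiff : ∀ᶠ i in l, DifferentiableOn ℂ (f i) (ball c (min ρ R)) :=
      hf.mono fun i hi => hi.mono (ball_subset_ball (min_le_right _ _))
    simpa [Pi.zero_def] using (tendstoLocallyUniformlyOn_iteratedDeriv isOpen_ball hdiff hunif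
      n).tendsto_at (mem_ball_self (lt_min hρ hR))
  have hdom : ∀ᶠ i in l, ∀ n : ℕ,
      ‖(n.factorial : ℂ)⁻¹ • (z - c) ^ n • iteratedDeriv n (f i) c‖ ≤ M * (‖z - c‖ / r) ^ n := by
    filter_upwards [hf, hM] with i hfi hMi n
    have hsub : closedBall c r ⊆ ball c R := closedBall_subset_ball hrR
    have hcauchy : ‖iteratedDeriv n (f i) c‖ ≤ n.factorial * M / r ^ n :=
      Complex.norm_iteratedDeriv_le_of_forall_mem_sphere_norm_le n hr
        (hfi.diffContOnCl_ball hsub) fun w hw => hMi w (hsub (sphere_subset_closedBall hw))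
    calc ‖(n.factorial : ℂ)⁻¹ • (z - c) ^ n • iteratedDeriv n (f i) c‖
        = (n.factorial : ℝ)⁻¹ * (‖z - c‖ ^ n * ‖iteratedDeriv n (f i) c‖) := by
          simp [norm_smul]
      _ ≤ (n.factorial : ℝ)⁻¹ * (‖z - c‖ ^ n * (n.factorial * M / r ^ n)) := by gcongr
      _ = M * (‖z - c‖ / r) ^ n := by
          rw [div_pow]
          field_simp
  have hsum : Summable fun n : ℕ => M * (‖z - c‖ / r) ^ n :=
    (summable_geometric_of_lt_one (by positivity) ((div_lt_one hr).2 hzr)).mul_left M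
  have hlim := tendsto_tsum_of_dominated_convergence hsum
    (fun n => ((hcoeff n).const_smul ((z - c) ^ n)).const_smul (n.factorial : ℂ)⁻¹) hdom
  simp only [smul_zero, tsum_zero] at hlim
  exact hlim.congr' (hf.mono fun i hi => Complex.taylorSeries_eq_on_ball hi hz)

end Vitali

section RealPart

theorem norm_le_of_re_le {f : ℂ → ℂ} {c z : ℂ} {r R M : ℝ} (hM : 0 < M) (hrR : r < R)
    (hf : DifferentiableOn ℂ f (ball c R)) (hfc : f c = 0)
    (hre : ∀ w ∈ ball c R, (f w).re ≤ M) (hz : z ∈ closedBall c r) :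
    ‖f z‖ ≤ 2 * M * r / (R - r) := by
  have hzr : ‖z - c‖ ≤ r := mem_closedBall_iff_norm.1 hz
  have hr : 0 ≤ r := (norm_nonneg _).trans hzr
  have hmaps : Set.MapsTo (fun w => c + w) (ball 0 R) (ball c R) := fun w hw => by
    simpa using hw
  have h := Complex.borelCaratheodory_zero hM
    (hf.comp (f := fun w => c + w) (by fun_prop) hmaps)
    (fun w hw => hre _ (hmaps hw)) (by linarith [norm_nonneg (z - c)])
    (mem_ball_zero_iff.2 (hzr.trans_lt hrR)) (by simpa using hfc)
  simp only [Function.comp_apply, add_sub_cancel] at h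
  refine h.trans ?_
  gcongr

theorem tendsto_zero_of_re_le {ι : Type*} {l : Filter ι} {f : ι → ℂ → ℂ} {c : ℂ} {ρ R M : ℝ}
    (hρ : 0 < ρ) (hM : 0 < M) (hf : ∀ᶠ i in l, DifferentiableOn ℂ (f i) (ball c R))
    (hfc : ∀ᶠ i in l, f i c = 0) (hre : ∀ᶠ i in l, ∀ w ∈ ball c R, (f i w).re ≤ M)
    (hsmall : ∀ ε > 0, ∀ᶠ i in l, ∀ w ∈ ball c ρ, (f i w).re ≤ ε) {z : ℂ} (hz : z ∈ ball c R) :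
    Tendsto (fun i => f i z) l (𝓝 0) := by
  obtain ⟨r, hzr, hrR⟩ := exists_between (mem_ball.1 hz)
  set ρ' := min ρ R
  have hρ'0 : 0 < ρ' := lt_min hρ (pos_of_mem_ball hz)
  have hunif : TendstoUniformlyOn f 0 l (ball c (ρ' / 2)) := by
    refine tendstoUniformlyOn_iff.2 fun ε hε => ?_
    filter_upwards [hf, hfc, hsmall (ε / 4) (by positivity)] with i hfi hfci hi w hw
    have h := norm_le_of_re_le (M := ε / 4) (by positivity) (half_lt_self hρ'0)
      (hfi.mono (ball_subset_ball (min_le_right _ _))) hfci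
      (fun w hw => hi w (ball_subset_ball (min_le_left _ _) hw)) (ball_subset_closedBall hw)
    rw [Pi.zero_apply, dist_zero_left]
    calc ‖f i w‖ ≤ 2 * (ε / 4) * (ρ' / 2) / (ρ' - ρ' / 2) := h
      _ = ε / 2 := by field_simp; ring
      _ < ε := half_lt_self hε
  refine tendsto_zero_of_tendstoUniformlyOn_ball (R := r) (M := 2 * M * r / (R - r))
    (half_pos hρ'0) (hf.mono fun i hi => hi.mono (ball_subset_ball hrR.le)) ?_ hunif hzr
  filter_upwards [hf, hfc, hre] with i hfi hfci hi w hw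
  exact norm_le_of_re_le hM hrR hfi hfci hi (ball_subset_closedBall hw)

end RealPart

section Logarithm

theorem exists_eq_mul_exp {F : ℂ → ℂ} {c : ℂ} {R : ℝ} (hF : DifferentiableOn ℂ F (ball c R))
    (hF0 : ∀ z ∈ ball c R, F z ≠ 0) :
    ∃ g : ℂ → ℂ, DifferentiableOn ℂ g (ball c R) ∧ g c = 0 ∧
      ∀ z ∈ ball c R, F z = F c * Complex.exp (g z) := by
  obtain ⟨g, hgc, hg⟩ := ((hF.deriv isOpen_ball).div hF hF0).isExactOn_ball.with_val_at c 0
  refine ⟨g, fun z hz => (hg z hz).differentiableAt.differentiableWithinAt, hgc, fun z hz => ?_⟩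
  have hderiv : ∀ w ∈ ball c R, HasDerivAt (fun w => F w * Complex.exp (-g w)) 0 w := by
    intro w hw
    have hFw := (hF.differentiableAt (isOpen_ball.mem_nhds hw)).hasDerivAt
    refine (hFw.mul (hg w hw).neg.cexp).congr_deriv ?_
    rw [Pi.div_apply]
    linear_combination -Complex.exp (-g w) * mul_div_cancel₀ (deriv F w) (hF0 w hw)
  have hconst : F z * Complex.exp (-g z) = F c * Complex.exp (-g c) :=
    isOpen_ball.is_const_of_deriv_eq_zero (convex_ball c R).isPreconnected
      (fun w hw => (hderiv w hw).differentiableAt.differentiableWithinAt)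
      (fun w hw => (hderiv w hw).deriv) hz (mem_ball_self (pos_of_mem_ball hz))
  rw [hgc, neg_zero, Complex.exp_zero, mul_one] at hconst
  rw [← hconst, mul_assoc, ← Complex.exp_add, neg_add_cancel, Complex.exp_zero, mul_one]

theorem re_le_log_add_mul_log {a w : ℂ} {κ K B : ℝ} {n : ℕ} (hκ : 0 < κ) (hB : 0 < B)
    (ha : κ ≤ ‖a‖) (h : ‖a * Complex.exp w‖ ≤ K * B ^ n) :
    w.re ≤ Real.log (K / κ) + n * Real.log B := by
  have hexp : Real.exp w.re ≤ K / κ * B ^ n := by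
    rw [norm_mul, Complex.norm_exp] at h
    rw [div_mul_eq_mul_div, le_div_iff₀ hκ, mul_comm]
    exact (mul_le_mul_of_nonneg_right ha (Real.exp_pos _).le).trans h
  have hK : K / κ ≠ 0 := fun hK => by
    rw [hK, zero_mul] at hexp
    exact hexp.not_gt (Real.exp_pos _)
  rw [← Real.log_pow, ← Real.log_mul hK (by positivity)]
  exact (Real.le_log_iff_exp_le ((Real.exp_pos _).trans_le hexp)).2 hexp

/-- The normalised logarithms `n⁻¹ log (F n / F n c)` have real part bounded above on the large
disc and asymptotically nonpositive on the small one, so they tend to zero. -/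
theorem eventually_norm_le_mul_pow {F : ℕ → ℂ → ℂ} {c : ℂ} {ρ R κ K B : ℝ} (hρ : 0 < ρ)
    (hκ : 0 < κ) (hB : 1 ≤ B) (hF : ∀ n, DifferentiableOn ℂ (F n) (ball c R))
    (hF0 : ∀ᶠ n in atTop, ∀ z ∈ ball c R, F n z ≠ 0) (hlow : ∀ᶠ n in atTop, κ ≤ ‖F n c‖)
    (hK : ∀ n, ∀ z ∈ ball c ρ, ‖F n z‖ ≤ K) (hKB : ∀ n, ∀ z ∈ ball c R, ‖F n z‖ ≤ K * B ^ n)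
    {z : ℂ} (hz : z ∈ ball c R) {q : ℝ} (hq : 1 < q) : ∀ᶠ n in atTop, ‖F n z‖ ≤ K * q ^ n := by
  obtain ⟨g, hg⟩ := (hF0.mono fun n hn => exists_eq_mul_exp (hF n) hn).choice
  have hlogdiv : Tendsto (fun n : ℕ => Real.log (K / κ) / n) atTop (𝓝 0) :=
    tendsto_const_div_atTop_nhds_zero_nat _
  have hre {σ A : ℝ} (hσ : σ ≤ R) (hA : 1 ≤ A)
      (hFA : ∀ n, ∀ w ∈ ball c σ, ‖F n w‖ ≤ K * A ^ n) {ε : ℝ} (hε : 0 < ε) :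
      ∀ᶠ n : ℕ in atTop, ∀ w ∈ ball c σ, (g n w / n).re ≤ ε + Real.log A := by
    filter_upwards [hg, hlow, hlogdiv.eventually_le_const hε, eventually_gt_atTop 0]
      with n hgn hlown hn hn0 w hw
    have hbound := re_le_log_add_mul_log hκ (one_pos.trans_le hA) hlown
      (hgn.2.2 w (ball_subset_ball hσ hw) ▸ hFA n w hw)
    have : (0 : ℝ) < n := Nat.cast_pos.2 hn0
    rw [Complex.div_natCast_re]
    calc (g n w).re / n ≤ (Real.log (K / κ) + n * Real.log A) / n := by gcongr
      _ = Real.log (K / κ) / n + Real.log A := by field_simp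
      _ ≤ ε + Real.log A := by gcongr
  have hlim : Tendsto (fun n => g n z / n) atTop (𝓝 0) := by
    refine tendsto_zero_of_re_le (f := fun n w => g n w / n) (ρ := min ρ R) (M := 1 + Real.log B)
      (lt_min hρ (pos_of_mem_ball hz)) (add_pos_of_pos_of_nonneg one_pos (Real.log_nonneg hB))
      (hg.mono fun n hn => hn.1.div_const _)
      (hg.mono fun n hn => by rw [hn.2.1, zero_div]) (hre le_rfl hB hKB one_pos) ?_ hz
    intro ε hε
    simpa using hre (min_le_right _ _) le_rfl
      (fun n w hw => by simpa using hK n w (ball_subset_ball (min_le_left _ _) hw)) hε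
  have hlim_re : Tendsto (fun n => (g n z / n).re) atTop (𝓝 0) :=
    (Complex.continuous_re.tendsto 0).comp hlim
  filter_upwards [hg, hlim_re.eventually_le_const (Real.log_pos hq), eventually_gt_atTop 0]
    with n hgn hn hn0
  rw [Complex.div_natCast_re, div_le_iff₀' (Nat.cast_pos.2 hn0), ← Real.log_pow,
    Real.le_log_iff_exp_le (by positivity)] at hn
  rw [hgn.2.2 z hz, norm_mul, Complex.norm_exp]
  exact mul_le_mul (hK n c (mem_ball_self hρ)) hn (Real.exp_pos _).le
    ((norm_nonneg _).trans (hK n c (mem_ball_self hρ)))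

end Logarithm

section Jentzsch

theorem norm_partialSum_le {𝕜 E F : Type*} [NontriviallyNormedField 𝕜] [NormedAddCommGroup E]
    [NormedSpace 𝕜 E] [NormedAddCommGroup F] [NormedSpace 𝕜 F] (p : FormalMultilinearSeries 𝕜 E F)
    {r : ℝ≥0} (hr0 : 0 < r) (hr : r < p.radius) {ρ : ℝ} (hrρ : r ≤ ρ) {x : E} (hx : ‖x‖ ≤ ρ)
    (n : ℕ) : ‖p.partialSum n x‖ ≤ (∑' k, ‖p k‖ * r ^ k) * (ρ / r) ^ n := by
  have hr0' : (0 : ℝ) < r := hr0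
  have hone : 1 ≤ ρ / r := (one_le_div hr0').2 hrρ
  calc ‖p.partialSum n x‖
      ≤ ∑ k ∈ Finset.range n, ‖p k‖ * r ^ k * (ρ / r) ^ n := by
        refine norm_sum_le_of_le _ fun k hk => ?_
        calc ‖p k fun _ => x‖ ≤ ‖p k‖ * ρ ^ k :=
            (p k).le_opNorm_mul_pow_of_le ((pi_norm_const_le x).trans hx)
          _ = ‖p k‖ * r ^ k * (ρ / r) ^ k := by
            rw [div_pow]
            field_simp
          _ ≤ ‖p k‖ * r ^ k * (ρ / r) ^ n := by
            gcongr
            exact (Finset.mem_range.1 hk).le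
    _ ≤ (∑' k, ‖p k‖ * r ^ k) * (ρ / r) ^ n := by
        rw [← Finset.sum_mul]
        gcongr
        exact (p.summable_norm_mul_pow hr).sum_le_tsum _ fun k _ => by positivity

theorem le_radius_of_norm_partialSum_le {𝕜 E : Type*} [NontriviallyNormedField 𝕜]
    [NormedAddCommGroup E] [NormedSpace 𝕜 E] (p : FormalMultilinearSeries 𝕜 𝕜 E) {z : 𝕜}
    (h : ∀ q : ℝ, 1 < q → ∃ K, ∀ᶠ n in atTop, ‖p.partialSum n z‖ ≤ K * q ^ n) :
    ‖z‖ₑ ≤ p.radius := by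
  refine ENNReal.le_of_forall_nnreal_lt fun r hr => ?_
  rcases eq_zero_or_pos r with rfl | hr0
  · simp
  have hr0' : (0 : ℝ) < r := hr0
  have hrz : (r : ℝ) < ‖z‖ := NNReal.coe_lt_coe.2 (ENNReal.coe_lt_coe.1 hr)
  obtain ⟨K, hK⟩ := h (‖z‖ / r) ((one_lt_div hr0').2 hrz)
  refine p.le_radius_of_eventually_le (K * (‖z‖ / r) + K) ?_
  filter_upwards [hK, (tendsto_add_atTop_nat 1).eventually hK] with n hn hn1
  have hterm : p.partialSum (n + 1) z - p.partialSum n z = p n fun _ => z := by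
    rw [partialSum, Finset.sum_range_succ, partialSum, add_sub_cancel_left]
  have hz0 : 0 < ‖z‖ := hr0'.trans hrz
  refine le_of_mul_le_mul_right ?_ (by positivity : 0 < (‖z‖ / r) ^ n)
  calc ‖p n‖ * r ^ n * (‖z‖ / r) ^ n = ‖p n fun _ => z‖ := by
        rw [apply_eq_pow_smul_coeff, norm_smul, norm_pow, norm_apply_eq_norm_coef, div_pow]
        field_simp
    _ ≤ ‖p.partialSum (n + 1) z‖ + ‖p.partialSum n z‖ := hterm ▸ norm_sub_le _ _
    _ ≤ K * (‖z‖ / r) ^ (n + 1) + K * (‖z‖ / r) ^ n := add_le_add hn1 hn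
    _ = (K * (‖z‖ / r) + K) * (‖z‖ / r) ^ n := by ring

theorem exists_eventually_norm_partialSum_le (p : FormalMultilinearSeries ℂ ℂ ℂ) {c : ℂ}
    (hc : ‖c‖ₑ < p.radius) (hpc : p.sum c ≠ 0) {R : ℝ}
    (hne : ∀ᶠ n in atTop, ∀ z ∈ ball c R, p.partialSum n z ≠ 0) {z : ℂ} (hz : z ∈ ball c R)
    {q : ℝ} (hq : 1 < q) : ∃ K, ∀ᶠ n in atTop, ‖p.partialSum n z‖ ≤ K * q ^ n := by
  obtain ⟨r, hcr, hr⟩ := ENNReal.lt_iff_exists_nnreal_btwn.1 hc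
  have hcr : ‖c‖ < r := NNReal.coe_lt_coe.2 (ENNReal.coe_lt_coe.1 hcr)
  have hr0 : (0 : ℝ) < r := (norm_nonneg c).trans_lt hcr
  have hR : 0 < R := pos_of_mem_ball hz
  have hlow : ∀ᶠ n in atTop, ‖p.sum c‖ / 2 ≤ ‖p.partialSum n c‖ := by
    have hlim := (p.hasFPowerSeriesOnBall (bot_le.trans_lt hc)).tendsto_partialSum
      (mem_eball_zero_iff.2 hc)
    rw [zero_add] at hlim
    exact hlim.norm.eventually_const_le (half_lt_self (norm_pos_iff.2 hpc))
  refine ⟨∑' k, ‖p k‖ * r ^ k, eventually_norm_le_mul_pow (ρ := r - ‖c‖) (B := (r + R) / r)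
    (sub_pos.2 hcr) (half_pos (norm_pos_iff.2 hpc)) ?_ ?_ hne hlow ?_ ?_ hz hq⟩
  · exact (one_le_div hr0).2 (by linarith)
  · intro n
    have hpoly : p.partialSum n = fun w => ∑ k ∈ Finset.range n, w ^ k • p.coeff k := by
      ext w
      simp only [partialSum, apply_eq_pow_smul_coeff]
    rw [hpoly]
    fun_prop
  · intro n w hw
    have hwr : ‖w‖ ≤ r := by
      linarith [norm_le_norm_add_norm_sub' w c, mem_ball_iff_norm.1 hw]
    simpa [div_self hr0.ne'] using norm_partialSum_le p hr0 hr le_rfl hwr n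
  · intro n w hw
    exact norm_partialSum_le p hr0 hr (by linarith)
      (by linarith [norm_le_norm_add_norm_sub' w c, mem_ball_iff_norm.1 hw]) n

theorem exists_mem_sum_ne_zero {E : Type*} [NormedAddCommGroup E] [NormedSpace ℂ E]
    [CompleteSpace E] {p : FormalMultilinearSeries ℂ ℂ E} (hp : p ≠ 0) {U : Set ℂ} (hU : IsOpen U)
    {z : ℂ} (hz : z ∈ U) (hzp : ‖z‖ₑ < p.radius) :
    ∃ c ∈ U, ‖c‖ₑ < p.radius ∧ p.sum c ≠ 0 := by
  by_contra! hzero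
  have hps := p.hasFPowerSeriesOnBall (bot_le.trans_lt hzp)
  have hloc : p.sum =ᶠ[𝓝 z] 0 := by
    filter_upwards [hU.mem_nhds hz, isOpen_eball.mem_nhds (mem_eball_zero_iff.2 hzp)] with w hwU hwp
    exact hzero w hwU (mem_eball_zero_iff.1 hwp)
  have hball : Set.EqOn p.sum 0 (eball 0 p.radius) :=
    hps.analyticOnNhd.eqOn_zero_of_preconnected_of_eventuallyEq_zero
      (convex_eball 0 p.radius).isPreconnected (mem_eball_zero_iff.2 hzp) hloc
  exact hp (hps.hasFPowerSeriesAt.eq_zero_of_eventually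
    (hball.eventuallyEq_of_mem (eball_mem_nhds 0 hps.r_pos)))

/-- If the partial sums had no zeros near `ζ`, they would grow subexponentially in a neighbourhood
of `ζ`, so the series would converge at points outside its disc of convergence. -/
theorem frequently_partialSum_eq_zero {p : FormalMultilinearSeries ℂ ℂ ℂ} {ζ : ℂ} (hζ0 : ζ ≠ 0)
    (hζ : p.radius = ‖ζ‖ₑ) : ∃ᶠ x : ℕ × ℂ in atTop ×ˢ 𝓝 ζ, p.partialSum x.1 x.2 = 0 := by
  intro hfree
  obtain ⟨P, hP, Q, hQ, hPQ⟩ := eventually_prod_iff.1 hfree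
  obtain ⟨ε, hε, hball⟩ := nhds_basis_ball.mem_iff.1 hQ
  have hne : ∀ᶠ n in atTop, ∀ z ∈ ball ζ ε, p.partialSum n z ≠ 0 :=
    hP.mono fun n hn z hz => hPQ hn (hball hz)
  have hp : p ≠ 0 := by
    rintro rfl
    exact enorm_ne_top (hζ.symm.trans zero_radius)
  obtain ⟨z, hzζ, hz⟩ : ∃ z ∈ ball ζ (ε / 2), ‖z‖ₑ < p.radius := by
    have hclosure : ζ ∈ closure (ball 0 ‖ζ‖) := by
      rw [closure_ball 0 (norm_ne_zero_iff.2 hζ0)]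
      exact mem_closedBall_zero_iff.2 le_rfl
    obtain ⟨z, hz, hzζ⟩ := Metric.mem_closure_iff.1 hclosure (ε / 2) (half_pos hε)
    exact ⟨z, mem_ball'.2 hzζ,
      hζ ▸ (lt_iff_lt_of_le_iff_le enorm_le_iff_norm_le).2 (mem_ball_zero_iff.1 hz)⟩
  obtain ⟨c, hcζ, hc, hpc⟩ := exists_mem_sum_ne_zero hp isOpen_ball hzζ hz
  obtain ⟨w, hwc, hw⟩ : ∃ w ∈ ball c (ε / 2), ‖ζ‖ₑ < ‖w‖ₑ := by
    by_contra! hle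
    have hinterior : ζ ∈ interior (closedBall 0 ‖ζ‖) := mem_interior.2
      ⟨ball c (ε / 2), fun w hw => mem_closedBall_zero_iff.2 (enorm_le_iff_norm_le.1 (hle w hw)),
        isOpen_ball, mem_ball_comm.1 hcζ⟩
    rw [interior_closedBall 0 (norm_ne_zero_iff.2 hζ0)] at hinterior
    exact (mem_ball_zero_iff.1 hinterior).false
  have hsub : ball c (ε / 2) ⊆ ball ζ ε := ball_subset_ball' (by linarith [mem_ball.1 hcζ])
  have hle : ‖w‖ₑ ≤ p.radius := le_radius_of_norm_partialSum_le p fun q hq =>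
    exists_eventually_norm_partialSum_le p hc hpc (hne.mono fun n hn x hx => hn x (hsub hx)) hwc hq
  exact (hle.trans_eq hζ).not_gt hw

end Jentzsch

section DoubleRoot

theorem discr_eq_zero_of_isRoot_derivative {R : Type*} [CommRing R] [IsDomain R] {f : R[X]}
    (hf : f ≠ 0) {x : R} (hx : f.IsRoot x) (hx' : f.derivative.IsRoot x) : f.discr = 0 := by
  have hdeg : 0 < f.degree := degree_pos_of_root hf hx
  have hnat : f.natDegree ≠ 0 := (natDegree_pos_iff_degree_pos.2 hdeg).ne'
  obtain ⟨a, b, -, -, hab⟩ := exists_mul_add_mul_eq_C_resultant f f.derivative le_rfl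
    (natDegree_derivative_le f) (Or.inl hnat)
  have hres : (-1) ^ (f.natDegree * (f.natDegree - 1) / 2) * f.leadingCoeff * f.discr = 0 := by
    simpa [hx.eq_zero, hx'.eq_zero, resultant_deriv hdeg, eq_comm] using congrArg (eval x) hab
  simpa [hf] using hres

theorem mul_eval_derivative {R : Type*} [CommSemiring R] (f : R[X]) (x : R) :
    x * f.derivative.eval x = f.sum fun j a => j * (a * x ^ j) := by
  rw [derivative_eval, sum_def, sum_def, Finset.mul_sum]
  refine Finset.sum_congr rfl fun j _ => ?_
  rcases j with _ | j
  · simp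
  · rw [Nat.add_sub_cancel]
    ring

end DoubleRoot

section Triangular

/-- The triangular numbers `0, 1, 3, 6, …`, which are the exponents of `q` in `Θ_n` and `Ψ_m`. -/
def triangular (k : ℕ) : ℕ := k * (k + 1) / 2

theorem two_mul_triangular (k : ℕ) : 2 * triangular k = k * (k + 1) :=
  Nat.mul_div_cancel' (Nat.even_mul_succ_self k).two_dvd

theorem triangular_add (j k : ℕ) : triangular (j + k) = triangular j + triangular k + j * k := by
  apply Nat.eq_of_mul_eq_mul_left two_pos
  simp only [mul_add, two_mul_triangular]
  ring

theorem triangular_succ (k : ℕ) : triangular (k + 1) = triangular k + (k + 1) := by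
  rw [triangular_add, mul_one, add_assoc, add_comm k]
  rfl

theorem triangular_strictMono : StrictMono triangular :=
  strictMono_nat_of_lt_succ fun k => by rw [triangular_succ]; omega

end Triangular

section PalindromicCentre

variable {R : Type*} [CommRing R] {q x : R} {m : ℕ}

theorem pow_triangular_mul_pow_add (hx : q ^ (m + 1) * x = -1) (k : ℕ) :
    q ^ triangular (m + 1 + k) * x ^ (m + 1 + k) =
      -((-1) ^ k * q ^ triangular k * (q ^ triangular m * x ^ m)) := by
  have hexp : triangular (m + 1 + k) = triangular m + triangular k + (m + 1) * (k + 1) := by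
    rw [triangular_add, triangular_succ]
    ring
  calc q ^ triangular (m + 1 + k) * x ^ (m + 1 + k)
      = q ^ triangular k * (q ^ triangular m * x ^ m) * (q ^ (m + 1) * x) ^ (k + 1) := by
        rw [hexp]
        ring
    _ = -((-1) ^ k * q ^ triangular k * (q ^ triangular m * x ^ m)) := by
        rw [hx]
        ring

theorem pow_triangular_mul_pow_sub (hx : q ^ (m + 1) * x = -1) {k : ℕ} (hk : k ≤ m) :
    q ^ triangular (m - k) * x ^ (m - k) =
      (-1) ^ k * q ^ triangular k * (q ^ triangular m * x ^ m) := by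
  obtain ⟨i, rfl⟩ := Nat.exists_eq_add_of_le' hk
  rw [Nat.add_sub_cancel]
  have hexp : triangular i + (i + k + 1) * k = triangular (i + k) + triangular k := by
    have h := two_mul_triangular k
    rw [triangular_add]
    linarith
  have hsign : (-1 : R) ^ k * (-1) ^ k = 1 := by rw [← mul_pow, neg_one_mul, neg_neg, one_pow]
  calc q ^ triangular i * x ^ i
      = (-1) ^ k * ((q ^ (i + k + 1) * x) ^ k * (q ^ triangular i * x ^ i)) := by
        rw [hx, ← mul_assoc, hsign, one_mul]
    _ = (-1) ^ k * (q ^ (triangular i + (i + k + 1) * k) * x ^ (i + k)) := by ring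
    _ = (-1) ^ k * q ^ triangular k * (q ^ triangular (i + k) * x ^ (i + k)) := by
        rw [hexp]
        ring

end PalindromicCentre

section TruncTheta

theorem sum_range_pair {M : Type*} [AddCommMonoid M] (f : ℕ → M) (m : ℕ) :
    ∑ j ∈ Finset.range (2 * m + 1 + 1), f j =
      ∑ k ∈ Finset.range (m + 1), (f (m - k) + f (m + 1 + k)) := by
  rw [show 2 * m + 1 + 1 = (m + 1) + (m + 1) by ring, Finset.sum_range_add, Finset.sum_add_distrib,
    ← Finset.sum_range_reflect]
  simp only [Nat.add_sub_cancel]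

theorem coeff_truncTheta (n : ℕ) (q : ℂ) (i : ℕ) :
    (truncTheta n q).coeff i = if i < n + 1 then q ^ triangular i else 0 := by
  simp only [truncTheta, finsetSum_coeff, coeff_C_mul, coeff_X_pow, mul_ite, mul_one, mul_zero,
    Finset.sum_ite_eq, Finset.mem_range, triangular]

theorem truncTheta_ne_zero (n : ℕ) (q : ℂ) : truncTheta n q ≠ 0 := fun h => by
  simpa [h, triangular] using coeff_truncTheta n q 0

theorem eval_truncTheta (n : ℕ) (q x : ℂ) :
    (truncTheta n q).eval x = ∑ j ∈ Finset.range (n + 1), q ^ triangular j * x ^ j := by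
  simp only [truncTheta, eval_finsetSum, eval_C_mul, eval_X_pow, triangular]

theorem mul_eval_derivative_truncTheta (n : ℕ) (q x : ℂ) :
    x * (truncTheta n q).derivative.eval x =
      ∑ j ∈ Finset.range (n + 1), j * (q ^ triangular j * x ^ j) := by
  rw [mul_eval_derivative, sum_over_range' _ (by simp) (n + 1)]
  · refine Finset.sum_congr rfl fun j hj => ?_
    rw [coeff_truncTheta, if_pos (Finset.mem_range.1 hj)]
  · refine (natDegree_lt_iff_degree_lt (truncTheta_ne_zero n q)).2
      ((degree_lt_iff_coeff_zero _ _).2 fun j hj => ?_)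
    rw [coeff_truncTheta, if_neg (by omega)]

theorem eval_Psi (m : ℕ) (q : ℂ) :
    (Psi m).eval q =
      ∑ k ∈ Finset.range (m + 1), (-1) ^ k * (2 * (k : ℂ) + 1) * q ^ triangular k := by
  simp only [Psi, eval_finsetSum, eval_C_mul, eval_X_pow, triangular]

theorem Psi_eval_zero (m : ℕ) : (Psi m).eval 0 = 1 := by
  rw [eval_Psi, Finset.sum_range_succ', Finset.sum_eq_zero fun k _ => ?_]
  · simp [triangular]
  · rw [triangular_succ, zero_pow (by omega), mul_zero]

variable {q x : ℂ} {m : ℕ}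

theorem isRoot_truncTheta (hx : q ^ (m + 1) * x = -1) :
    (truncTheta (2 * m + 1) q).IsRoot x := by
  rw [IsRoot, eval_truncTheta, sum_range_pair]
  refine Finset.sum_eq_zero fun k hk => ?_
  rw [pow_triangular_mul_pow_add hx,
    pow_triangular_mul_pow_sub hx (Finset.mem_range_succ_iff.1 hk), add_neg_cancel]

theorem mul_eval_derivative_truncTheta_eq_Psi (hx : q ^ (m + 1) * x = -1) :
    x * (truncTheta (2 * m + 1) q).derivative.eval x =
      -(q ^ triangular m * x ^ m) * (Psi m).eval q := by
  rw [mul_eval_derivative_truncTheta, sum_range_pair, eval_Psi, Finset.mul_sum]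
  refine Finset.sum_congr rfl fun k hk => ?_
  have hkm : k ≤ m := Finset.mem_range_succ_iff.1 hk
  rw [pow_triangular_mul_pow_add hx, pow_triangular_mul_pow_sub hx hkm, Nat.cast_sub hkm]
  push_cast
  ring

theorem mem_truncSpec_of_isRoot_Psi (h : (Psi m).IsRoot q) : q ∈ truncSpec (2 * m + 1) := by
  have hq : q ≠ 0 := by
    rintro rfl
    exact one_ne_zero ((Psi_eval_zero m).symm.trans h)
  have hx : q ^ (m + 1) * -(q ^ (m + 1))⁻¹ = -1 := by
    rw [mul_neg, mul_inv_cancel₀ (pow_ne_zero _ hq)]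
  refine ⟨hq, discr_eq_zero_of_isRoot_derivative (truncTheta_ne_zero _ _)
    (isRoot_truncTheta hx) ?_⟩
  have hder := mul_eval_derivative_truncTheta_eq_Psi hx
  rw [h.eq_zero, mul_zero] at hder
  exact (mul_eq_zero.1 hder).resolve_left (neg_ne_zero.2 (inv_ne_zero (pow_ne_zero _ hq)))

end TruncTheta

section PsiSeries

/-- The power series `∑ (-1)^k (2k+1) q^{k(k+1)/2}`, of which the polynomials `Ψ_m` are partial
sums. Its coefficient of index `n` is zero unless `n` is triangular. -/
noncomputable def psiSeries : FormalMultilinearSeries ℂ ℂ ℂ :=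
  ofScalars ℂ
    (Function.extend triangular (fun k => (-1 : ℂ) ^ k * (2 * (k : ℂ) + 1)) 0)

theorem norm_psiSeries_triangular (k : ℕ) : ‖psiSeries (triangular k)‖ = 2 * k + 1 := by
  rw [psiSeries, ofScalars_norm,
    triangular_strictMono.injective.extend_apply, norm_mul, norm_pow, norm_neg, norm_one, one_pow,
    one_mul]
  exact_mod_cast Complex.norm_natCast (2 * k + 1)

theorem psiSeries_eq_zero {n : ℕ} (hn : n ∉ Set.range triangular) : psiSeries n = 0 :=
  ofScalars_eq_zero_of_scalar_zero ℂ (Function.extend_apply' _ _ n hn)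

theorem norm_psiSeries_le (n : ℕ) : ‖psiSeries n‖ ≤ 2 * n + 1 := by
  by_cases hn : n ∈ Set.range triangular
  · obtain ⟨k, rfl⟩ := hn
    rw [norm_psiSeries_triangular]
    gcongr
    exact triangular_strictMono.le_apply
  · rw [psiSeries_eq_zero hn, norm_zero]
    positivity

theorem radius_psiSeries : psiSeries.radius = 1 := by
  refine le_antisymm (le_of_not_gt fun h => ?_) (ENNReal.le_of_forall_nnreal_lt fun r hr => ?_)
  · have hsum : Summable fun n => ‖psiSeries n‖ := by
      simpa using psiSeries.summable_norm_mul_pow (r := 1) h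
    refine not_lt_of_ge (ge_of_tendsto'
      (hsum.tendsto_atTop_zero.comp triangular_strictMono.tendsto_atTop) fun k => ?_) one_pos
    rw [Function.comp_apply, norm_psiSeries_triangular]
    linarith [k.cast_nonneg (α := ℝ)]
  · have hr1 : |(r : ℝ)| < 1 := by simpa using hr
    have hbound : Tendsto (fun n : ℕ => (2 * n + 1) * (r : ℝ) ^ n) atTop (𝓝 0) := by
      simpa [add_mul, mul_assoc] using
        ((tendsto_self_mul_const_pow_of_abs_lt_one hr1).const_mul 2).add
          (tendsto_pow_atTop_nhds_zero_of_abs_lt_one hr1)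
    refine psiSeries.le_radius_of_tendsto (l := 0)
      (squeeze_zero (fun n => by positivity) (fun n => ?_) hbound)
    gcongr
    exact norm_psiSeries_le n

theorem partialSum_psiSeries {m n : ℕ} (hmn : triangular m < n) (hnm : n ≤ triangular (m + 1))
    (z : ℂ) : psiSeries.partialSum n z = (Psi m).eval z := by
  have hsub : (Finset.range (m + 1)).image triangular ⊆ Finset.range n := by
    refine Finset.image_subset_iff.2 fun k hk => Finset.mem_range.2 ?_
    exact (triangular_strictMono.monotone (Finset.mem_range_succ_iff.1 hk)).trans_lt hmn
  rw [partialSum, ← Finset.sum_subset hsub,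
    Finset.sum_image triangular_strictMono.injective.injOn, eval_Psi]
  · refine Finset.sum_congr rfl fun k _ => ?_
    rw [psiSeries, ofScalars_apply_eq,
      triangular_strictMono.injective.extend_apply, smul_eq_mul]
  · intro i hi hi'
    rw [psiSeries_eq_zero, _root_.zero_apply]
    rintro ⟨k, rfl⟩
    have hk : k < m + 1 := triangular_strictMono.lt_iff_lt.1 ((Finset.mem_range.1 hi).trans_le hnm)
    exact hi' (Finset.mem_image_of_mem _ (Finset.mem_range.2 hk))

theorem frequently_isRoot_Psi {ζ : ℂ} (hζ : ‖ζ‖ = 1) :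
    ∃ᶠ x : ℕ × ℂ in atTop ×ˢ 𝓝 ζ, (Psi x.1).IsRoot x.2 := by
  have hbetween : ∀ᶠ n in atTop, ∃ m, triangular m < n ∧ n ≤ triangular (m + 1) :=
    (eventually_gt_atTop 0).mono fun n hn =>
      triangular_strictMono.exists_between_of_tendsto_atTop triangular_strictMono.tendsto_atTop hn
  obtain ⟨m, hm⟩ := hbetween.choice
  have hm_tendsto : Tendsto m atTop atTop := tendsto_atTop.2 fun b => by
    filter_upwards [hm, eventually_gt_atTop (triangular b)] with n hmn hn
    exact Nat.lt_succ_iff.1 (triangular_strictMono.lt_iff_lt.1 (hn.trans_le hmn.2))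
  have hzeros : ∃ᶠ x : ℕ × ℂ in atTop ×ˢ 𝓝 ζ, psiSeries.partialSum x.1 x.2 = 0 :=
    frequently_partialSum_eq_zero (norm_ne_zero_iff.1 (hζ ▸ one_ne_zero))
      (by rw [radius_psiSeries, ← ofReal_norm, hζ, ENNReal.ofReal_one])
  refine (hm_tendsto.prodMap tendsto_id).frequently
    ((hzeros.and_eventually (hm.prod_inl _)).mono ?_)
  rintro ⟨n, z⟩ ⟨hz, hmn⟩
  exact (partialSum_psiSeries hmn.1 hmn.2 z).symm.trans hz

end PsiSeries

end PartialTheta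

theorem mainTheorem4 (ζ : ℂ) (hζ : ‖ζ‖ = 1) :
    ∃ (m : ℕ → ℕ) (q : ℕ → ℂ),
      Tendsto m atTop atTop ∧
      (∀ s, q s ∈ PartialTheta.truncSpec (2 * m s + 1)) ∧
      (∀ s, (PartialTheta.Psi (m s)).IsRoot (q s)) ∧
      Tendsto q atTop (𝓝 ζ) := by
  obtain ⟨x, hx, hroot⟩ := exists_seq_forall_of_frequently (PartialTheta.frequently_isRoot_Psi hζ)
  exact ⟨fun s => (x s).1, fun s => (x s).2, tendsto_fst.comp hx,
    fun s => PartialTheta.mem_truncSpec_of_isRoot_Psi (hroot s), hroot, tendsto_snd.comp hx⟩
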